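/- For $k\ge 2$ let $S_k$ be the slab with vertex set $\mathbb{Z}^2\times\{0,\dots,k-1\}$ and nearest-neighbour edges ($\|x-y\|_1=1$); with periodic boundary conditions one adds, for each $(a,b)\in\mathbb{Z}^2$, an edge between $(a,b,0)$ and $(a,b,k-1)$, and with free boundary conditions no edge is added. Consider the zero-temperature Glauber dynamics (coarsening) on $S_k$: the initial spins $\sigma_x(0)\in\{-1,+1\}$ are independent and fair, each site carries an independent rate-one Poisson clock, and when the clock of $x$ rings at time $t$, with $e_x(t^-)=-\sum_{y\sim x}\sigma_x(t^-)\sigma_y(t^-)$ (sum over the edges at $x$), the spin $\sigma_x$ flips if $e_x(t^-)>0$, is replaced by the value of an independent fair $\pm1$ coin if $e_x(t^-)=0$, and is unchanged if $e_x(t^-)<0$. A site $x$ fixates if $\sigma_x(t)$ is constant for all $t\ge T$, for some (random) $T<\infty$, and $S_k$ fixates if almost surely all of its sites fixate. (i) With periodic boundary conditions and $k\ge 4$, $S_k$ does not fixate; in fact the site $(0,0,0)$ fixates with probability strictly less than $1$. (ii) With free boundary conditions and $k\ge 3$, $S_k$ does not fixate. -/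

import Mathlib

open MeasureTheory ProbabilityTheory Filter

noncomputable section

namespace Coarsening

/-! ### The slabs -/

/-- The vertex set `ℤ² × {0, …, k - 1}` of the slab of thickness `k`. -/
abbrev Site (k : ℕ) : Type := (ℤ × ℤ) × Fin k

/-- Boundary conditions in the third coordinate. -/
inductive Boundary : Type
  | free
  | periodic

/-- The number of nearest-neighbour edges (`ℓ¹`-distance one) between `x` and `y`: `0` or `1`. -/
def latticeEdges {k : ℕ} (x y : Site k) : ℕ :=
  if |x.1.1 - y.1.1| + |x.1.2 - y.1.2| + |(x.2 : ℤ) - (y.2 : ℤ)| = 1 then 1 else 0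

/-- The number of extra edges joining the bottom level `0` to the top level `k - 1`
above the same point of `ℤ²`: `0` or `1`. -/
def wrapEdges {k : ℕ} (x y : Site k) : ℕ :=
  if x.1 = y.1 ∧ (((x.2 : ℕ) = 0 ∧ (y.2 : ℕ) + 1 = k) ∨ ((y.2 : ℕ) = 0 ∧ (x.2 : ℕ) + 1 = k))
  then 1 else 0

/-- The number of edges between `x` and `y` in the slab. (For periodic boundary conditions and
`k = 2` vertical neighbours are joined by two edges; for `k ≥ 3` all values are `0` or `1`.) -/
def edges (bc : Boundary) {k : ℕ} (x y : Site k) : ℕ :=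
  match bc with
  | .free => latticeEdges x y
  | .periodic => latticeEdges x y + wrapEdges x y

/-- A finite box around `x` which contains all its neighbours. -/
def box {k : ℕ} (x : Site k) : Finset (Site k) :=
  (Finset.Icc (x.1.1 - 1) (x.1.1 + 1) ×ˢ Finset.Icc (x.1.2 - 1) (x.1.2 + 1)) ×ˢ Finset.univ

theorem edges_eq_zero_of_notMem_box (bc : Boundary) {k : ℕ} (x y : Site k) (h : y ∉ box x) :
    edges bc x y = 0 := by
  have key : ¬ (|x.1.1 - y.1.1| ≤ 1 ∧ |x.1.2 - y.1.2| ≤ 1) := by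
    rintro ⟨h1, h2⟩
    rw [abs_le] at h1 h2
    apply h
    simp only [box, Finset.mem_product, Finset.mem_Icc, Finset.mem_univ, and_true]
    omega
  have h1 : latticeEdges x y = 0 := by
    unfold latticeEdges
    rw [if_neg]
    intro h'
    have a1 := abs_nonneg (x.1.1 - y.1.1)
    have a2 := abs_nonneg (x.1.2 - y.1.2)
    have a3 := abs_nonneg ((x.2 : ℤ) - (y.2 : ℤ))
    exact key ⟨by omega, by omega⟩
  have h2 : wrapEdges x y = 0 := by
    unfold wrapEdges
    rw [if_neg]
    rintro ⟨h', -⟩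
    exact key (by simp [h'])
  cases bc <;> simp [edges, h1, h2]

/-! ### Energy and the update rule -/

/-- Spin configurations with spins in `{-1, 1}`. -/
abbrev Config (k : ℕ) : Type := Site k → ℤˣ

/-- The energy of the site `x`: minus the sum of `η x * η y` over all edges from `x` to some `y`. -/
def energy (bc : Boundary) {k : ℕ} (η : Config k) (x : Site k) : ℤ :=
  - ∑ y ∈ box x, (edges bc x y : ℤ) * ((η x : ℤ) * (η y : ℤ))

/-- The new spin at `x` when its clock rings in the configuration `η`: `x` flips if its energy is
positive, takes the value of a fair coin if it is zero, and keeps its spin if it is negative. -/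
def updatedSpin (bc : Boundary) {k : ℕ} (η : Config k) (x : Site k) (coin : ℤˣ) : ℤˣ :=
  if 0 < energy bc η x then - η x
  else if energy bc η x = 0 then coin
  else η x

/-! ### The randomness -/

/-- A realization of all the randomness. Each site carries its initial spin and, for its `n`-th
ring, the waiting time between the previous ring (or time `0`) and that ring, and the coin that is
used then in the case of a tie. -/
abbrev Sample (k : ℕ) : Type := Site k → ℤˣ × (ℕ → ℝ × ℤˣ)

/-- The law of a fair `±1`-valued random variable. -/
def fairSpin : Measure ℤˣ := (PMF.uniformOfFintype ℤˣ).toMeasure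

instance : IsProbabilityMeasure fairSpin := by
  unfold fairSpin; infer_instance

instance : IsProbabilityMeasure (expMeasure 1) := isProbabilityMeasure_expMeasure one_pos

/-- The law `ℙ`: initial spins, waiting times and coins are all independent; initial spins and coins
are fair, waiting times are exponential of rate one. -/
def law (k : ℕ) : Measure (Sample k) :=
  Measure.infinitePi fun _ : Site k =>
    fairSpin.prod (Measure.infinitePi fun _ : ℕ => (expMeasure 1).prod fairSpin)

instance (k : ℕ) : IsProbabilityMeasure (law k) := by
  unfold law; infer_instance

/-- The initial configuration `σ(0)`. -/
def initialSpin {k : ℕ} (ω : Sample k) (v : Site k) : ℤˣ := (ω v).1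

/-- The coin used at the `n`-th ring of the clock of `v` (counting from `n = 0`). -/
def coin {k : ℕ} (ω : Sample k) (v : Site k) (n : ℕ) : ℤˣ := ((ω v).2 n).2

/-- The time of the `n`-th ring of the clock of `v` (counting from `n = 0`). -/
def ringTime {k : ℕ} (ω : Sample k) (v : Site k) (n : ℕ) : ℝ :=
  ∑ i ∈ Finset.range (n + 1), ((ω v).2 i).1

/-- The number of rings of the clock of `v` strictly before time `t`. -/
def ringsBefore {k : ℕ} (ω : Sample k) (v : Site k) (t : ℝ) : ℕ :=
  {n : ℕ | ringTime ω v n < t}.ncard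

/-- The number of rings of the clock of `v` up to and including time `t`. -/
def ringsUpTo {k : ℕ} (ω : Sample k) (v : Site k) (t : ℝ) : ℕ :=
  {n : ℕ | ringTime ω v n ≤ t}.ncard

/-! ### The dynamics (graphical construction)

The spin of `v` after its `n`-th ring is determined by the spins of `v` and its neighbours just
before that ring, each of which was determined at an earlier ring, and so on. Almost surely, tracing
back in this way ends after finitely many steps in initial spins. -/

/-- The spin of `v` after its first `n` rings, if the graphical construction is traced back through
at most `m` successive rings (and initial spins are used beyond that). -/
def tracedSpin (bc : Boundary) {k : ℕ} (ω : Sample k) : ℕ → Site k → ℕ → ℤˣ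
  | _, v, 0 => initialSpin ω v
  | 0, v, _ + 1 => initialSpin ω v
  | m + 1, v, n + 1 =>
      updatedSpin bc (fun y => tracedSpin bc ω m y (ringsBefore ω y (ringTime ω v n))) v
        (coin ω v n)

/-- The spin of `v` after its first `n` rings: the value of `tracedSpin` for all large depths. -/
def spinAfter (bc : Boundary) {k : ℕ} (ω : Sample k) (v : Site k) (n : ℕ) : ℤˣ :=
  Classical.epsilon fun s : ℤˣ => ∀ᶠ m in atTop, tracedSpin bc ω m v n = s

/-- The spin `σ_v(t)` at time `t`. -/
def spin (bc : Boundary) {k : ℕ} (ω : Sample k) (t : ℝ) (v : Site k) : ℤˣ :=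
  spinAfter bc ω v (ringsUpTo ω v t)

/-- The spin `σ_v(t⁻)` just before time `t`. -/
def spinBefore (bc : Boundary) {k : ℕ} (ω : Sample k) (t : ℝ) (v : Site k) : ℤˣ :=
  spinAfter bc ω v (ringsBefore ω v t)

/-! The following facts confirm that this is the dynamics described by the update rule. -/

theorem spinAfter_zero (bc : Boundary) {k : ℕ} (ω : Sample k) (v : Site k) :
    spinAfter bc ω v 0 = initialSpin ω v := by
  have h : ∃ s : ℤˣ, ∀ᶠ m in atTop, tracedSpin bc ω m v 0 = s :=
    ⟨initialSpin ω v, Eventually.of_forall fun m => by cases m <;> rfl⟩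
  obtain ⟨m, hm⟩ := (Classical.epsilon_spec h).exists
  unfold spinAfter
  rw [← hm]
  cases m <;> rfl

theorem energy_congr (bc : Boundary) {k : ℕ} {η ζ : Config k} {x : Site k}
    (h : ∀ y ∈ box x, η y = ζ y) : energy bc η x = energy bc ζ x := by
  have hx : η x = ζ x := h x (by simp [box])
  unfold energy
  rw [hx, Finset.sum_congr rfl fun y hy => by rw [h y hy]]

theorem updatedSpin_congr (bc : Boundary) {k : ℕ} {η ζ : Config k} {x : Site k} (c : ℤˣ)
    (h : ∀ y ∈ box x, η y = ζ y) : updatedSpin bc η x c = updatedSpin bc ζ x c := by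
  have hx : η x = ζ x := h x (by simp [box])
  unfold updatedSpin
  rw [energy_congr bc h, hx]

/-- If tracing back ends at every ring, then after each ring at a time `t` the spin of `v` is the
one obtained from `σ(t⁻)` by the update rule. -/
theorem spinAfter_succ (bc : Boundary) {k : ℕ} (ω : Sample k)
    (hω : ∀ y n, ∃ s : ℤˣ, ∀ᶠ m in atTop, tracedSpin bc ω m y n = s) (v : Site k) (n : ℕ) :
    spinAfter bc ω v (n + 1) =
      updatedSpin bc (spinBefore bc ω (ringTime ω v n)) v (coin ω v n) := by
  have h1 : ∀ᶠ m in atTop, tracedSpin bc ω m v (n + 1) = spinAfter bc ω v (n + 1) :=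
    Classical.epsilon_spec (hω v (n + 1))
  have h2 : ∀ᶠ m in atTop, ∀ y ∈ box v,
      tracedSpin bc ω m y (ringsBefore ω y (ringTime ω v n)) =
        spinBefore bc ω (ringTime ω v n) y :=
    (Filter.eventually_all_finset (box v)).2 fun y _ => Classical.epsilon_spec (hω y _)
  obtain ⟨m, hm1, hm2⟩ := (((tendsto_add_atTop_nat 1).eventually h1).and h2).exists
  rw [← hm1]
  exact updatedSpin_congr bc _ hm2

/-- The paths follow the update rule: at each ring of `v`, the spin `σ_v(t)` is obtained from
`σ(t⁻)` by the update rule. -/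
theorem spin_ringTime (bc : Boundary) {k : ℕ} (ω : Sample k)
    (hω : ∀ y n, ∃ s : ℤˣ, ∀ᶠ m in atTop, tracedSpin bc ω m y n = s) (v : Site k)
    (hv : StrictMono (ringTime ω v)) (n : ℕ) :
    spin bc ω (ringTime ω v n) v =
      updatedSpin bc (spinBefore bc ω (ringTime ω v n)) v (coin ω v n) := by
  have h : ringsUpTo ω v (ringTime ω v n) = n + 1 := by
    have hs : {m : ℕ | ringTime ω v m ≤ ringTime ω v n} = (Finset.range (n + 1) : Finset ℕ) := by
      ext m
      simp [hv.le_iff_le]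
    rw [ringsUpTo, hs, Set.ncard_coe_finset, Finset.card_range]
  rw [spin, h, spinAfter_succ bc ω hω]

/-! ### Fixation -/

/-- The site `v` fixates in the realization `ω`: its spin is constant from some finite time on. -/
def SiteFixates (bc : Boundary) {k : ℕ} (ω : Sample k) (v : Site k) : Prop :=
  ∃ T : ℝ, 0 ≤ T ∧ ∀ t : ℝ, T ≤ t → spin bc ω t v = spin bc ω T v

/-- The slab of thickness `k` fixates: almost surely, every site fixates. -/
def SlabFixates (bc : Boundary) (k : ℕ) : Prop :=
  ∀ᵐ ω ∂(law k), ∀ v : Site k, SiteFixates bc ω v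

end Coarsening

end

/-! Fixation fails because of a finite obstruction that is present initially with positive
probability. A finite set F with spins ξ is frozen if each of its sites has negative energy whatever
the spins outside F are; if the initial spins on F are ξ, no site of F ever flips. Let U be a finite
set whose neighbours all lie in F or U, such that no configuration extending ξ has negative energy
at every site of U. If all sites of U fixated, their final spins together with ξ would leave some
site of U with energy at least 0. Its clock rings at arbitrarily late times with either coin, so it
would flip once more, a contradiction (`IsFrozen.not_forall_siteFixates`). Since F is finite, the
initial spins on F are ξ with positive probability (`not_ae_siteFixates_of_isFrozen`).

It remains to find F and U. With free boundary conditions U is a single site on level 1 with three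
frozen plus and three frozen minus neighbours: a permanent tie. With periodic boundary conditions U
is a row of four sites on level 0. At each of them the frozen neighbours off the row cancel, and the
two ends of the row face frozen spins of opposite signs, so somewhere along the row adjacent spins
differ, and a site of U next to that place has energy at least 0. By translation invariance the four
sites fixate with the same probability, which gives the claim for (0,0,0).

The frozen sets are pictures made of digits, whose stability is a finite computation
(`freePattern_stable`, `periodicPattern_stable`). Thicker slabs repeat the last level, which does
not harm stability because a repeated level agrees with its copy. -/

noncomputable section

namespace Coarsening

variable {k : ℕ} {bc : Boundary}

/-! ### Clocks -/

/-- The clock and the coins at `v` behave as they almost surely do: waiting times are positive, and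
both values of the coin occur infinitely often at the end of a waiting time longer than one. -/
structure RegularAt (ω : Sample k) (v : Site k) : Prop where
  wait_pos : ∀ n, 0 < ((ω v).2 n).1
  frequently : ∀ s : ℤˣ, ∃ᶠ n in atTop, 1 < ((ω v).2 n).1 ∧ coin ω v n = s

namespace RegularAt

variable {ω : Sample k} {v : Site k}

theorem strictMono_ringTime (h : RegularAt ω v) : StrictMono (ringTime ω v) :=
  strictMono_nat_of_lt_succ fun n => by
    unfold ringTime
    rw [Finset.sum_range_succ _ (n + 1)]
    exact lt_add_of_pos_right _ (h.wait_pos _)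

/-- Infinitely many waiting times exceed one, so they do not tend to zero and their sum diverges. -/
theorem tendsto_ringTime (h : RegularAt ω v) : Tendsto (ringTime ω v) atTop atTop := by
  have hs : ¬ Summable fun i => ((ω v).2 i).1 := fun hs => by
    have h1 := hs.tendsto_atTop_zero.eventually (gt_mem_nhds one_pos)
    obtain ⟨n, hn, hn'⟩ := ((h.frequently 1).and_eventually h1).exists
    exact lt_asymm hn.1 hn'
  exact ((not_summable_iff_tendsto_nat_atTop_of_nonneg fun n => (h.wait_pos n).le).1 hs).comp
    (tendsto_add_atTop_nat 1)

theorem exists_coin_eq (h : RegularAt ω v) (T : ℝ) (s : ℤˣ) :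
    ∃ n, T < ringTime ω v n ∧ coin ω v n = s := by
  obtain ⟨n, hn, hT⟩ :=
    ((h.frequently s).and_eventually (h.tendsto_ringTime.eventually_gt_atTop T)).exists
  exact ⟨n, hT, hn.2⟩

/-- The ring times increase to infinity, so the rings counted form a finite initial segment of ℕ and
`ncard` is a genuine count. -/
theorem lt_ringsBefore_iff (h : RegularAt ω v) {t : ℝ} {n : ℕ} :
    n < ringsBefore ω v t ↔ ringTime ω v n < t := by
  obtain ⟨N, hN⟩ := (h.tendsto_ringTime.eventually_ge_atTop t).exists
  have hex : ∃ N, t ≤ ringTime ω v N := ⟨N, hN⟩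
  classical
  have hs : {m : ℕ | ringTime ω v m < t} = (Finset.range (Nat.find hex) : Finset ℕ) := by
    ext m
    simp only [Set.mem_ofPred_eq, Finset.coe_range, Set.mem_Iio, Nat.lt_find_iff, not_le]
    exact ⟨fun hm j hj => (h.strictMono_ringTime.monotone hj).trans_lt hm, fun hm => hm m le_rfl⟩
  have h2 : ringsBefore ω v t = Nat.find hex := by
    rw [ringsBefore, hs, Set.ncard_coe_finset, Finset.card_range]
  rw [h2, ← Finset.mem_range, ← Finset.mem_coe, ← hs]
  rfl

theorem lt_ringsUpTo_iff (h : RegularAt ω v) {t : ℝ} {n : ℕ} :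
    n < ringsUpTo ω v t ↔ ringTime ω v n ≤ t := by
  obtain ⟨N, hN⟩ := (h.tendsto_ringTime.eventually_gt_atTop t).exists
  have hex : ∃ N, t < ringTime ω v N := ⟨N, hN⟩
  classical
  have hs : {m : ℕ | ringTime ω v m ≤ t} = (Finset.range (Nat.find hex) : Finset ℕ) := by
    ext m
    simp only [Set.mem_ofPred_eq, Finset.coe_range, Set.mem_Iio, Nat.lt_find_iff, not_lt]
    exact ⟨fun hm j hj => (h.strictMono_ringTime.monotone hj).trans hm, fun hm => hm m le_rfl⟩
  have h2 : ringsUpTo ω v t = Nat.find hex := by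
    rw [ringsUpTo, hs, Set.ncard_coe_finset, Finset.card_range]
  rw [h2, ← Finset.mem_range, ← Finset.mem_coe, ← hs]
  rfl

theorem ringsUpTo_ringTime (h : RegularAt ω v) (n : ℕ) :
    ringsUpTo ω v (ringTime ω v n) = n + 1 := by
  refine le_antisymm (not_lt.1 fun hlt => ?_) (h.lt_ringsUpTo_iff.2 le_rfl)
  exact (h.strictMono_ringTime n.lt_succ_self).not_ge (h.lt_ringsUpTo_iff.1 hlt)

theorem ringsBefore_mono (h : RegularAt ω v) {s t : ℝ} (hst : s ≤ t) :
    ringsBefore ω v s ≤ ringsBefore ω v t :=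
  le_of_forall_lt fun _ hn => h.lt_ringsBefore_iff.2 ((h.lt_ringsBefore_iff.1 hn).trans_le hst)

theorem ringsBefore_ringTime (h : RegularAt ω v) (n : ℕ) :
    ringsBefore ω v (ringTime ω v n) = n :=
  eq_of_forall_lt_iff fun _ => h.lt_ringsBefore_iff.trans h.strictMono_ringTime.lt_iff_lt

/-- Just before a time `t`, no ring occurs. -/
theorem exists_ringsUpTo_eq_ringsBefore (h : RegularAt ω v) {T t : ℝ} (hT : T < t) :
    ∃ t', T ≤ t' ∧ ringsUpTo ω v t' = ringsBefore ω v t := by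
  rcases hn : ringsBefore ω v t with _ | n
  · refine ⟨T, le_rfl, Nat.eq_zero_of_not_pos fun h0 => ?_⟩
    have h1 := h.lt_ringsBefore_iff.2 ((h.lt_ringsUpTo_iff.1 h0).trans_lt hT)
    omega
  · have hlt : ringTime ω v n < t := h.lt_ringsBefore_iff.1 (by omega)
    refine ⟨max T (ringTime ω v n), le_max_left _ _, le_antisymm (not_lt.1 fun h1 => ?_) ?_⟩
    · have h2 := h.lt_ringsBefore_iff.2 ((h.lt_ringsUpTo_iff.1 h1).trans_lt (max_lt hT hlt))
      omega
    · exact h.lt_ringsUpTo_iff.2 (le_max_right _ _)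

end RegularAt

/-! ### Dynamics around a frozen set -/

/-- Unlike `energy_congr`, this looks only at true neighbours: other sites of the box may lie
outside `F ∪ U`, where nothing is known about the dynamics. -/
theorem energy_congr_of_edges {η ζ : Config k} {x : Site k} (hx : η x = ζ x)
    (h : ∀ y, edges bc x y ≠ 0 → η y = ζ y) : energy bc η x = energy bc ζ x := by
  unfold energy
  congr 1
  refine Finset.sum_congr rfl fun y _ => ?_
  by_cases hy : edges bc x y = 0
  · simp [hy]
  · rw [hx, h y hy]

theorem updatedSpin_congr_of_edges {η ζ : Config k} {x : Site k} (c : ℤˣ) (hx : η x = ζ x)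
    (h : ∀ y, edges bc x y ≠ 0 → η y = ζ y) : updatedSpin bc η x c = updatedSpin bc ζ x c := by
  unfold updatedSpin
  rw [energy_congr_of_edges hx h, hx]

/-- The configuration `ξ` on `F` is strictly stable, whatever the spins outside `F` are. -/
def IsFrozen (bc : Boundary) (F : Finset (Site k)) (ξ : Config k) : Prop :=
  ∀ v ∈ F, ∀ η : Config k, (∀ y ∈ F, η y = ξ y) → energy bc η v < 0

/-- Induction on the depth. Truncated tracing falls back on initial spins, which are also given by
`ξ`, so nothing has to be assumed about the clocks. -/
theorem IsFrozen.tracedSpin_eq {F : Finset (Site k)} {ξ : Config k} (hF : IsFrozen bc F ξ)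
    {ω : Sample k} (hω : ∀ v ∈ F, initialSpin ω v = ξ v) (m : ℕ) :
    ∀ v ∈ F, ∀ n, tracedSpin bc ω m v n = ξ v := by
  induction m with
  | zero =>
    intro v hv n
    cases n <;> exact hω v hv
  | succ m ih =>
    intro v hv n
    cases n with
    | zero => exact hω v hv
    | succ n =>
      have he := hF v hv (fun y => tracedSpin bc ω m y (ringsBefore ω y (ringTime ω v n)))
        fun y hy => ih y hy _
      rw [tracedSpin, updatedSpin, if_neg he.not_gt, if_neg he.ne]
      exact ih v hv _

theorem IsFrozen.spinAfter_eq {F : Finset (Site k)} {ξ : Config k} (hF : IsFrozen bc F ξ)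
    {ω : Sample k} (hω : ∀ v ∈ F, initialSpin ω v = ξ v) {v : Site k} (hv : v ∈ F) (n : ℕ) :
    spinAfter bc ω v n = ξ v := by
  have h : ∃ s : ℤˣ, ∀ᶠ m in atTop, tracedSpin bc ω m v n = s :=
    ⟨ξ v, Eventually.of_forall fun m => hF.tracedSpin_eq hω m v hv n⟩
  obtain ⟨m, hm⟩ := (Classical.epsilon_spec h).exists
  exact hm.symm.trans (hF.tracedSpin_eq hω m v hv n)

/-- If tracing back from `v` and its neighbours ends, then after each ring of `v` its spin is the
one obtained by the update rule. -/
theorem spinAfter_succ_of_neighbors {ω : Sample k} {v : Site k}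
    (hv : ∀ n, ∃ s : ℤˣ, ∀ᶠ m in atTop, tracedSpin bc ω m v n = s)
    (hω : ∀ y, edges bc v y ≠ 0 → ∀ n, ∃ s : ℤˣ, ∀ᶠ m in atTop, tracedSpin bc ω m y n = s)
    (n : ℕ) :
    spinAfter bc ω v (n + 1) =
      updatedSpin bc (spinBefore bc ω (ringTime ω v n)) v (coin ω v n) := by
  have h1 : ∀ᶠ m in atTop, tracedSpin bc ω m v (n + 1) = spinAfter bc ω v (n + 1) :=
    Classical.epsilon_spec (hv (n + 1))
  have h2 : ∀ᶠ m in atTop, ∀ y ∈ box v, edges bc v y ≠ 0 →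
      tracedSpin bc ω m y (ringsBefore ω y (ringTime ω v n)) =
        spinBefore bc ω (ringTime ω v n) y := by
    refine (Filter.eventually_all_finset (box v)).2 fun y _ => ?_
    by_cases hy : edges bc v y = 0
    · simp [hy]
    · filter_upwards [Classical.epsilon_spec (hω y hy _)] with m hm _ using hm
  have h3 : ∀ᶠ m in atTop, tracedSpin bc ω m v (ringsBefore ω v (ringTime ω v n)) =
      spinBefore bc ω (ringTime ω v n) v := Classical.epsilon_spec (hv _)
  obtain ⟨m, hm1, hm2, hm3⟩ :=
    (((tendsto_add_atTop_nat 1).eventually h1).and (h2.and h3)).exists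
  rw [← hm1]
  exact updatedSpin_congr_of_edges _ hm3 fun y hy =>
    hm2 y (by_contra fun h => hy (edges_eq_zero_of_notMem_box bc v y h)) hy

/-- Tracing back ends at the sites of a finite set enclosed by a frozen one. -/
theorem IsFrozen.exists_eventually_tracedSpin_eq {F U : Finset (Site k)} {ξ : Config k}
    (hF : IsFrozen bc F ξ) (hU : ∀ u ∈ U, ∀ y, edges bc u y ≠ 0 → y ∈ F ∨ y ∈ U)
    {ω : Sample k} (hω : ∀ v ∈ F, initialSpin ω v = ξ v) (hr : ∀ u ∈ U, RegularAt ω u) :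
    ∀ u ∈ U, ∀ n, ∃ s : ℤˣ, ∀ᶠ m in atTop, tracedSpin bc ω m u n = s := by
  -- The induction is on the total number of rings in `U` before the ring considered. A step back
  -- either enters `F`, where the spin is constant, or reaches an initial spin, or reaches a
  -- strictly earlier ring in `U`, which lowers this number.
  suffices H : ∀ N, ∀ u ∈ U, ∀ n, ∑ w ∈ U, ringsBefore ω w (ringTime ω u n) < N →
      ∃ s : ℤˣ, ∀ᶠ m in atTop, tracedSpin bc ω m u (n + 1) = s by
    intro u hu n
    cases n with
    | zero => exact ⟨initialSpin ω u, Eventually.of_forall fun m => by cases m <;> rfl⟩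
    | succ n => exact H _ u hu n (Nat.lt_succ_self _)
  intro N
  induction N with
  | zero => intro u _ n h; omega
  | succ N ih =>
    intro u hu n hN
    have key : ∀ y, y ∈ F ∨ y ∈ U → ∃ s : ℤˣ, ∀ᶠ m in atTop,
        tracedSpin bc ω m y (ringsBefore ω y (ringTime ω u n)) = s := by
      rintro y (hy | hy)
      · exact ⟨ξ y, Eventually.of_forall fun m => hF.tracedSpin_eq hω m y hy _⟩
      · rcases hn : ringsBefore ω y (ringTime ω u n) with _ | j
        · exact ⟨initialSpin ω y, Eventually.of_forall fun m => by cases m <;> rfl⟩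
        · have hlt : ringTime ω y j < ringTime ω u n := (hr y hy).lt_ringsBefore_iff.1 (by omega)
          refine ih y hy j ((Finset.sum_lt_sum (fun w hw => (hr w hw).ringsBefore_mono hlt.le)
            ⟨y, hy, ?_⟩).trans_le (Nat.lt_succ_iff.1 hN))
          rw [(hr y hy).ringsBefore_ringTime, hn]
          exact j.lt_succ_self
    choose! s hs using key
    refine ⟨updatedSpin bc s u (coin ω u n), ?_⟩
    have h2 : ∀ᶠ m in atTop, ∀ y ∈ F ∪ U,
        tracedSpin bc ω m y (ringsBefore ω y (ringTime ω u n)) = s y :=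
      (Filter.eventually_all_finset _).2 fun y hy => hs y (Finset.mem_union.1 hy)
    obtain ⟨M, hM⟩ := eventually_atTop.1 h2
    refine eventually_atTop.2 ⟨M + 1, fun m hm => ?_⟩
    obtain ⟨m, rfl⟩ := Nat.exists_eq_add_of_le' (Nat.one_le_of_lt hm)
    have hm' : M ≤ m := Nat.lt_succ_iff.1 hm
    exact updatedSpin_congr_of_edges _ (hM m hm' u (Finset.mem_union_right _ hu)) fun y hy =>
      hM m hm' y (Finset.mem_union.2 (hU u hu y hy))

/-- No configuration that agrees with `ξ` on `F` is strictly stable on `U`. -/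
def IsRestless (bc : Boundary) (F U : Finset (Site k)) (ξ : Config k) : Prop :=
  ∀ η : Config k, (∀ y ∈ F, η y = ξ y) → ∃ u ∈ U, 0 ≤ energy bc η u

/-- A site at which some update is possible cannot keep its spin forever; so the sites of a restless
set, enclosed by a frozen set, do not all fixate. -/
theorem IsFrozen.not_forall_siteFixates {F U : Finset (Site k)} {ξ : Config k}
    (hF : IsFrozen bc F ξ) (hU : ∀ u ∈ U, ∀ y, edges bc u y ≠ 0 → y ∈ F ∨ y ∈ U)
    (hFU : IsRestless bc F U ξ)
    {ω : Sample k} (hω : ∀ v ∈ F, initialSpin ω v = ξ v) (hr : ∀ u ∈ U, RegularAt ω u) :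
    ¬ ∀ u ∈ U, SiteFixates bc ω u := by
  intro hfix
  choose! T _ hT using hfix
  have hconv := hF.exists_eventually_tracedSpin_eq hU hω hr
  classical
  have hbefore : ∀ u ∈ U, ∀ t, T u < t → spinBefore bc ω t u = spin bc ω (T u) u := by
    intro u hu t ht
    obtain ⟨t', ht', h⟩ := (hr u hu).exists_ringsUpTo_eq_ringsBefore ht
    rw [spinBefore, ← h]
    exact hT u hu t' ht'
  -- The limiting configuration on `F ∪ U`; its values elsewhere are arbitrary and have no influence
  -- on the energies in `U`.
  obtain ⟨u, hu, he⟩ := hFU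
    (fun y => if y ∈ F then ξ y else spin bc ω (T y) y) fun y hy => if_pos hy
  -- The sum exceeds every fixation time in `U`. The coin is chosen opposite to the final spin, so
  -- that the update reverses the spin both for positive energy and for a tie.
  obtain ⟨n, hn, hcoin⟩ := (hr u hu).exists_coin_eq (∑ w ∈ U, |T w|) (- spin bc ω (T u) u)
  have hTn : ∀ w ∈ U, T w < ringTime ω u n := fun w hw =>
    ((le_abs_self _).trans (Finset.single_le_sum (f := fun w => |T w|)
      (fun _ _ => abs_nonneg _) hw)).trans_lt hn
  have hagree : ∀ y, y ∈ F ∨ y ∈ U → spinBefore bc ω (ringTime ω u n) y =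
      if y ∈ F then ξ y else spin bc ω (T y) y := by
    intro y hy
    split_ifs with h
    · exact hF.spinAfter_eq hω h _
    · exact hbefore y (hy.resolve_left h) _ (hTn y (hy.resolve_left h))
  have hafter : spin bc ω (ringTime ω u n) u = updatedSpin bc
      (spinBefore bc ω (ringTime ω u n)) u (coin ω u n) := by
    rw [spin, (hr u hu).ringsUpTo_ringTime]
    refine spinAfter_succ_of_neighbors (hconv u hu) (fun y hy m => ?_) n
    rcases hU u hu y hy with h | h
    · exact ⟨ξ y, Eventually.of_forall fun j => hF.tracedSpin_eq hω j y h m⟩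
    · exact hconv y h m
  rw [hT u hu _ (hTn u hu).le, hcoin] at hafter
  have hene : 0 ≤ energy bc (spinBefore bc ω (ringTime ω u n)) u := by
    rwa [energy_congr_of_edges (hagree u (Or.inr hu)) fun y hy => hagree y (hU u hu y hy)]
  have hne : spin bc ω (T u) u ≠ - spin bc ω (T u) u := by
    rcases Int.units_eq_one_or (spin bc ω (T u) u) with h | h <;> rw [h] <;> decide
  refine hne (hafter.trans ?_)
  unfold updatedSpin
  rw [hbefore u hu _ (hTn u hu)]
  rcases hene.lt_or_eq with h | h
  · rw [if_pos h]
  · rw [if_neg h.not_lt, if_pos h.symm]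

/-! ### Probabilities -/

instance : MeasurableSingletonClass ℤˣ where
  measurableSet_singleton s :=
    ⟨{(s : ℤ)}, MeasurableSet.singleton _, by ext; simp [Units.ext_iff]⟩

theorem fairSpin_singleton_ne_zero (s : ℤˣ) : fairSpin {s} ≠ 0 := by
  rw [fairSpin, PMF.toMeasure_apply_singleton _ _ (MeasurableSet.singleton s)]
  simp [PMF.uniformOfFintype_apply]

theorem expMeasure_Iic_zero : expMeasure 1 (Set.Iic 0) = 0 := by
  have h := cdf_expMeasure_eq one_pos 0
  rw [cdf_eq_real] at h
  simpa [measureReal_eq_zero_iff] using h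

theorem expMeasure_Ioi_one_ne_zero : expMeasure 1 (Set.Ioi 1) ≠ 0 := by
  have h := cdf_expMeasure_eq one_pos 1
  rw [cdf_eq_real] at h
  intro h0
  have h1 := probReal_add_probReal_compl (μ := expMeasure 1) (s := Set.Iic (1 : ℝ)) measurableSet_Iic
  rw [Set.compl_Iic, Measure.real, Measure.real, h0] at h1
  rw [Measure.real] at h
  rw [h] at h1
  simp at h1

/-- The law of the waiting times and coins of one site. -/
def clockLaw : Measure (ℕ → ℝ × ℤˣ) :=
  Measure.infinitePi fun _ : ℕ => (expMeasure 1).prod fairSpin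

instance : IsProbabilityMeasure clockLaw := by
  unfold clockLaw; infer_instance

theorem ae_clockLaw_wait_pos : ∀ᵐ f ∂clockLaw, ∀ n, 0 < (f n).1 := by
  refine ae_all_iff.2 fun n => ?_
  have h : ∀ᵐ x ∂expMeasure 1, 0 < x := by
    rw [ae_iff]
    simp only [not_lt]
    exact expMeasure_Iic_zero
  exact (measurePreserving_eval_infinitePi (fun _ : ℕ => (expMeasure 1).prod fairSpin)
    n).quasiMeasurePreserving.ae (Measure.quasiMeasurePreserving_fst.ae h)

/-- Second Borel–Cantelli lemma: the events concern distinct coordinates, hence are independent, and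
they share one positive probability. -/
theorem ae_clockLaw_frequently (s : ℤˣ) :
    ∀ᵐ f ∂clockLaw, ∃ᶠ n in atTop, 1 < (f n).1 ∧ (f n).2 = s := by
  set B : Set (ℝ × ℤˣ) := Set.Ioi 1 ×ˢ {s} with hB
  have hBm : MeasurableSet B := measurableSet_Ioi.prod (MeasurableSet.singleton s)
  have hm : ∀ n : ℕ, MeasurableSet {f : ℕ → ℝ × ℤˣ | f n ∈ B} := fun n =>
    measurable_pi_apply n hBm
  have hμ : ∀ n : ℕ, clockLaw {f | f n ∈ B} = ((expMeasure 1).prod fairSpin) B := fun n =>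
    (measurePreserving_eval_infinitePi _ n).measure_preimage hBm.nullMeasurableSet
  have hB0 : ((expMeasure 1).prod fairSpin) B ≠ 0 := by
    rw [hB, Measure.prod_prod]
    exact mul_ne_zero expMeasure_Ioi_one_ne_zero (fairSpin_singleton_ne_zero s)
  have hind : iIndepSet (fun n : ℕ => {f : ℕ → ℝ × ℤˣ | f n ∈ B}) clockLaw := by
    rw [iIndepSet_iff_meas_biInter hm]
    intro S
    have h1 : ⋂ i ∈ S, {f : ℕ → ℝ × ℤˣ | f i ∈ B} = Set.pi S fun _ => B := by
      ext f; simp [Set.mem_pi]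
    rw [h1, clockLaw, Measure.infinitePi_pi _ fun _ _ => hBm]
    exact Finset.prod_congr rfl fun i _ => (hμ i).symm
  have h := measure_limsup_eq_one hm hind (by simp [hμ, ENNReal.tsum_const_eq_top_of_ne_zero hB0])
  have hlm : MeasurableSet (limsup (fun n : ℕ => {f : ℕ → ℝ × ℤˣ | f n ∈ B}) atTop) :=
    MeasurableSet.measurableSet_limsup hm
  have h2 := (prob_compl_eq_zero_iff hlm).2 h
  have h3 : ∀ᵐ f ∂clockLaw, f ∈ limsup (fun n : ℕ => {f : ℕ → ℝ × ℤˣ | f n ∈ B}) atTop := by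
    rw [ae_iff]; exact h2
  filter_upwards [h3] with f hf
  rw [mem_limsup_iff_frequently_mem] at hf
  exact hf.mono fun n hn => ⟨hn.1, hn.2⟩

theorem ae_regularAt (v : Site k) : ∀ᵐ ω ∂law k, RegularAt ω v := by
  have h : ∀ᵐ f ∂clockLaw, (∀ n, 0 < (f n).1) ∧
      ∀ s : ℤˣ, ∃ᶠ n in atTop, 1 < (f n).1 ∧ (f n).2 = s :=
    ae_clockLaw_wait_pos.and (ae_all_iff.2 ae_clockLaw_frequently)
  have h2 := (measurePreserving_eval_infinitePi
    (fun _ : Site k => fairSpin.prod clockLaw) v).quasiMeasurePreserving.ae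
    (Measure.quasiMeasurePreserving_snd.ae h)
  filter_upwards [h2] with ω hω
  exact ⟨hω.1, hω.2⟩

theorem law_initialSpin_ne_zero (F : Finset (Site k)) (ξ : Config k) :
    law k {ω | ∀ v ∈ F, initialSpin ω v = ξ v} ≠ 0 := by
  have h : {ω : Sample k | ∀ v ∈ F, initialSpin ω v = ξ v} =
      Set.pi F fun v => {ξ v} ×ˢ Set.univ := by
    ext ω; simp [Set.mem_pi, initialSpin]
  rw [h, law, Measure.infinitePi_pi _ fun v _ =>
    (MeasurableSet.singleton (ξ v)).prod MeasurableSet.univ]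
  refine Finset.prod_ne_zero_iff.2 fun v _ => ?_
  rw [Measure.prod_prod, measure_univ, mul_one]
  exact fairSpin_singleton_ne_zero _

theorem not_ae_siteFixates_of_isFrozen {F U : Finset (Site k)} {ξ : Config k}
    (hF : IsFrozen bc F ξ) (hU : ∀ u ∈ U, ∀ y, edges bc u y ≠ 0 → y ∈ F ∨ y ∈ U)
    (hFU : IsRestless bc F U ξ) :
    ¬ ∀ᵐ ω ∂law k, ∀ u ∈ U, SiteFixates bc ω u := by
  intro h
  refine law_initialSpin_ne_zero F ξ (measure_eq_zero_iff_ae_notMem.2 ?_)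
  filter_upwards [h, ae_all_iff.2 fun v => ae_regularAt v] with ω hfix hr hω
  exact hF.not_forall_siteFixates hU hFU hω (fun u _ => hr u) hfix

/-! ### Translations -/

/-- Horizontal translation by `p`. -/
def translate (p : ℤ × ℤ) : Site k ≃ Site k := (Equiv.addRight p).prodCongr (Equiv.refl _)

theorem edges_translate (p : ℤ × ℤ) (x y : Site k) :
    edges bc (translate p x) (translate p y) = edges bc x y := by
  have h1 : latticeEdges (translate p x) (translate p y) = latticeEdges x y := by
    simp [latticeEdges, translate]
  have h2 : wrapEdges (translate p x) (translate p y) = wrapEdges x y := by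
    simp [wrapEdges, translate]
  cases bc <;> simp [edges, h1, h2]

theorem box_translate (p : ℤ × ℤ) (x : Site k) :
    box (translate p x) = (box x).map (translate p).toEmbedding := by
  ext y
  obtain ⟨y, rfl⟩ := (translate p).surjective y
  simp only [box, translate, Finset.mem_product, Finset.mem_Icc, Finset.mem_univ, and_true,
    Finset.mem_map_equiv, Equiv.symm_apply_apply]
  simp
  omega

theorem energy_translate (p : ℤ × ℤ) (η : Config k) (x : Site k) :
    energy bc η (translate p x) = energy bc (η ∘ translate p) x := by
  simp [energy, box_translate, edges_translate]

theorem tracedSpin_translate (p : ℤ × ℤ) (ω : Sample k) (m : ℕ) :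
    ∀ v n, tracedSpin bc (ω ∘ translate p) m v n = tracedSpin bc ω m (translate p v) n := by
  induction m with
  | zero => intro v n; cases n <;> rfl
  | succ m ih =>
    intro v n
    cases n with
    | zero => rfl
    | succ n =>
      simp only [tracedSpin, updatedSpin, ih, energy_translate]
      rfl

theorem siteFixates_translate (p : ℤ × ℤ) (ω : Sample k) (v : Site k) :
    SiteFixates bc (ω ∘ translate p) v ↔ SiteFixates bc ω (translate p v) := by
  have h : ∀ t, spin bc (ω ∘ translate p) t v = spin bc ω t (translate p v) := fun t => by
    simp only [spin, spinAfter, tracedSpin_translate]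
    rfl
  simp only [SiteFixates, h]

/-- The law is a product of identical factors, so permuting the sites preserves it, and the dynamics
commutes with horizontal translations. -/
theorem ae_siteFixates_translate (p : ℤ × ℤ) {v : Site k}
    (h : ∀ᵐ ω ∂law k, SiteFixates bc ω v) : ∀ᵐ ω ∂law k, SiteFixates bc ω (translate p v) := by
  have hq : MeasurePreserving (fun ω : Sample k => ω ∘ translate p) (law k) (law k) := by
    refine ⟨measurable_pi_lambda _ fun v => measurable_pi_apply _, ?_⟩
    exact Measure.map_infinitePi_infinitePi_of_inj
      (P := fun _ : Site k => fairSpin.prod clockLaw) (translate p).injective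
  filter_upwards [hq.quasiMeasurePreserving.ae h] with ω hω
  exact (siteFixates_translate p ω v).1 hω

/-! ### The energy as a sum over neighbours -/

/-- The level above `l`, cyclically. -/
def upLevel (l : Fin k) : Fin k :=
  if h : (l : ℕ) + 1 < k then ⟨l + 1, h⟩ else ⟨0, l.pos⟩

/-- The level below `l`, cyclically. -/
def downLevel (l : Fin k) : Fin k :=
  if (l : ℕ) = 0 then ⟨k - 1, Nat.sub_one_lt_of_lt l.pos⟩ else ⟨l - 1, by omega⟩

theorem val_upLevel (l : Fin k) : (upLevel l : ℕ) = if (l : ℕ) + 1 < k then (l : ℕ) + 1 else 0 := by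
  unfold upLevel; split_ifs <;> rfl

theorem val_downLevel (l : Fin k) : (downLevel l : ℕ) = if (l : ℕ) = 0 then k - 1 else l - 1 := by
  unfold downLevel; split_ifs <;> rfl

/-- Whether there is an edge from level `l` upwards. -/
def HasUp (bc : Boundary) (l : Fin k) : Prop := bc = .free → (l : ℕ) + 1 < k

/-- Whether there is an edge from level `l` downwards. -/
def HasDown (bc : Boundary) (l : Fin k) : Prop := bc = .free → 0 < (l : ℕ)

open Classical in
-- Cyclic levels treat both boundary conditions at once: `HasUp` and `HasDown` switch off the
-- wrapping edges in the free case.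
theorem edges_eq_sum (hk : 3 ≤ k) (a b : ℤ) (l : Fin k) (y : Site k) :
    (edges bc ((a, b), l) y : ℤ) =
      (if y = ((a + 1, b), l) then 1 else 0) + (if y = ((a - 1, b), l) then 1 else 0) +
      (if y = ((a, b + 1), l) then 1 else 0) + (if y = ((a, b - 1), l) then 1 else 0) +
      (if y = ((a, b), upLevel l) ∧ HasUp bc l then 1 else 0) +
      (if y = ((a, b), downLevel l) ∧ HasDown bc l then 1 else 0) := by
  obtain ⟨⟨c, d⟩, m⟩ := y
  have hl := l.isLt
  have hm := m.isLt
  have habs : ∀ z : ℤ, |z| = if 0 ≤ z then z else -z := fun z => by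
    split_ifs with h
    · exact abs_of_nonneg h
    · exact abs_of_neg (not_le.1 h)
  cases bc <;>
  simp only [edges, latticeEdges, wrapEdges, HasUp, HasDown, Prod.mk.injEq, Fin.ext_iff,
    val_upLevel, val_downLevel, habs, Nat.cast_ite, Nat.cast_add, reduceCtorEq, false_imp_iff,
    true_imp_iff, and_true, Nat.cast_one, Nat.cast_zero]
  · grind (splits := 40)
  · grind (splits := 40)

open Classical in
theorem energy_eq (hk : 3 ≤ k) (η : Config k) (a b : ℤ) (l : Fin k) :
    energy bc η ((a, b), l) = - ((η ((a, b), l) : ℤ) * η ((a + 1, b), l) +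
      (η ((a, b), l) : ℤ) * η ((a - 1, b), l) + (η ((a, b), l) : ℤ) * η ((a, b + 1), l) +
      (η ((a, b), l) : ℤ) * η ((a, b - 1), l) +
      (if HasUp bc l then (η ((a, b), l) : ℤ) * η ((a, b), upLevel l) else 0) +
      (if HasDown bc l then (η ((a, b), l) : ℤ) * η ((a, b), downLevel l) else 0)) := by
  have hbox : ∀ (c d : ℤ) (m : Fin k), a - 1 ≤ c → c ≤ a + 1 → b - 1 ≤ d → d ≤ b + 1 →
      ((c, d), m) ∈ box ((a, b), l) := by
    intro c d m h1 h2 h3 h4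
    simp [box, *]
  unfold energy
  simp only [edges_eq_sum hk, add_mul, Finset.sum_add_distrib, ite_and, ite_mul, one_mul, zero_mul,
    Finset.sum_ite_eq']
  rw [if_pos (hbox _ _ _ (by omega) (by omega) (by omega) (by omega)),
    if_pos (hbox _ _ _ (by omega) (by omega) (by omega) (by omega)),
    if_pos (hbox _ _ _ (by omega) (by omega) (by omega) (by omega)),
    if_pos (hbox _ _ _ (by omega) (by omega) (by omega) (by omega)),
    if_pos (hbox _ _ _ (by omega) (by omega) (by omega) (by omega)),
    if_pos (hbox _ _ _ (by omega) (by omega) (by omega) (by omega))]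

theorem mem_neighbors_of_edges_ne_zero (hk : 3 ≤ k) {a b : ℤ} {l : Fin k} {y : Site k}
    (h : edges bc ((a, b), l) y ≠ 0) :
    y = ((a + 1, b), l) ∨ y = ((a - 1, b), l) ∨ y = ((a, b + 1), l) ∨ y = ((a, b - 1), l) ∨
      (y = ((a, b), upLevel l) ∧ HasUp bc l) ∨ (y = ((a, b), downLevel l) ∧ HasDown bc l) := by
  by_contra hc
  push Not at hc
  obtain ⟨h1, h2, h3, h4, h5, h6⟩ := hc
  apply h
  have := edges_eq_sum (bc := bc) hk a b l y
  rw [if_neg h1, if_neg h2, if_neg h3, if_neg h4, if_neg fun h => h5 h.1 h.2,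
    if_neg fun h => h6 h.1 h.2] at this
  exact_mod_cast this

/-! ### Patterns

A pattern prescribes, at each point of `ℤ²` and each level, the spin `1` or `-1`, or nothing (`0`).
Its last level is repeated to fit the thickness of the slab. -/

/-- The sign of the `i`-th decimal digit of `n`, from the right: `1` stands for `1`, `2` for `-1`
and other digits for `0`. -/
def digitSign (n i : ℕ) : ℤ :=
  if n / 10 ^ i % 10 = 1 then 1 else if n / 10 ^ i % 10 = 2 then -1 else 0

/-- The sign at `(x, y)` of a picture whose rows are given from top to bottom, with the last digit
of the first row at `(a, b)`. -/
def pictureSign (rows : List ℕ) (a b x y : ℤ) : ℤ :=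
  if x ≤ a ∧ y ≤ b then digitSign (rows.getD (b - y).toNat 0) (a - x).toNat else 0

/-- Rows of the levels `0`, `1` and `≥ 2`, for free boundary conditions. -/
def freeRows : ℕ → List ℕ
  | 0 => [2221122, 2021122, 2221122, 2221122, 2221112, 1111112,
          1111112, 2222222, 2222222]
  | 1 => [2221122, 2021122, 2222222, 2222222, 2220112, 1111112,
          1111112, 2222022, 2222222]
  | _ => [2221122, 2021122, 2222222, 2222222, 2222112, 1122112,
          1122112, 2222222, 2222222]

/-- Rows of the levels `0`, `1`, `2` and `≥ 3`, for periodic boundary conditions. -/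
def periodicRows : ℕ → List ℕ
  | 0 => [1111111111, 1122222221, 2222222221, 2111111111, 2111111111, 2110000221,
          2222222221, 2222222221, 2111111211, 2111111211, 2222222211]
  | 1 => [1111111111, 1122211221, 2222211221, 2111111111, 2111111111, 2111111221,
          2111111221, 2111111221, 2111111211, 2111111211, 2222222211]
  | 2 => [1111111111, 1122211221, 2222211221, 2112211221, 2112211221, 2112211221,
          2112211021, 2112211221, 2112211211, 2112211211, 2222222211]
  | _ => [1111111111, 1122222221, 2222222221, 2112222221, 2112222221, 2112222221,
          2222222021, 2222222221, 2112211211, 2112211211, 2222222211]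

/-- A pattern around the site `(0, 0, 1)`, supported on `[-3, 3] × [-4, 4]`. -/
def freePattern (x y : ℤ) (j : ℕ) : ℤ :=
  -- The explicit lower bounds make the support evident without computing digits.
  if -3 ≤ x ∧ -4 ≤ y then pictureSign (freeRows j) 3 4 x y else 0

/-- A pattern around the sites `(i, 0, 0)`, `0 ≤ i ≤ 3`, supported on `[-3, 6] × [-5, 5]`. -/
def periodicPattern (x y : ℤ) (j : ℕ) : ℤ :=
  if -3 ≤ x ∧ -5 ≤ y then pictureSign (periodicRows j) 6 5 x y else 0

theorem digitSign_mem (n i : ℕ) : digitSign n i = 0 ∨ digitSign n i = 1 ∨ digitSign n i = -1 := by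
  unfold digitSign; split_ifs <;> simp

theorem pictureSign_mem (rows : List ℕ) (a b x y : ℤ) : pictureSign rows a b x y = 0 ∨
    pictureSign rows a b x y = 1 ∨ pictureSign rows a b x y = -1 := by
  unfold pictureSign
  split_ifs
  · exact digitSign_mem _ _
  · simp

/-- `1` if the signs are equal and `-1` otherwise. -/
def agreement (s t : ℤ) : ℤ := if s = t then 1 else -1

theorem agreement_le_one (s t : ℤ) : agreement s t ≤ 1 := by
  unfold agreement; split_ifs <;> decide

theorem agreement_self (s : ℤ) : agreement s s = 1 := if_pos rfl

/-- The sum of the agreements of a pattern at a point with its horizontal neighbours. -/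
def horizontalAgreement (P : ℤ → ℤ → ℕ → ℤ) (x y : ℤ) (j : ℕ) : ℤ :=
  agreement (P x y j) (P (x + 1) y j) + agreement (P x y j) (P (x - 1) y j) +
    agreement (P x y j) (P x (y + 1) j) + agreement (P x y j) (P x (y - 1) j)

/-- The spin prescribed at a site by a pattern with levels `0, …, K`. -/
def prescribed (P : ℤ → ℤ → ℕ → ℤ) (K : ℕ) (v : Site k) : ℤ := P v.1.1 v.1.2 (min v.2 K)

/-- A configuration with the spins prescribed by a pattern. -/
def patternConfig (P : ℤ → ℤ → ℕ → ℤ) (K : ℕ) : Config k :=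
  fun v => if prescribed P K v = 1 then 1 else -1

/-- The sites of `[-N, N]² × {0, …, k - 1}` at which a pattern prescribes a spin. -/
def patternSites (P : ℤ → ℤ → ℕ → ℤ) (K : ℕ) (N : ℤ) : Finset (Site k) :=
  ((Finset.Icc (-N) N ×ˢ Finset.Icc (-N) N) ×ˢ Finset.univ).filter fun v => prescribed P K v ≠ 0

/-- A pattern which prescribes only spins, and only in `[-N, N]²`. -/
structure IsPattern (P : ℤ → ℤ → ℕ → ℤ) (N : ℤ) : Prop where
  mem : ∀ x y j, P x y j = 0 ∨ P x y j = 1 ∨ P x y j = -1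
  support : ∀ x y j, P x y j ≠ 0 → (-N ≤ x ∧ x ≤ N) ∧ (-N ≤ y ∧ y ≤ N)

section

variable {P : ℤ → ℤ → ℕ → ℤ} {K : ℕ} {N : ℤ}

theorem IsPattern.mem_prescribed (hP : IsPattern P N) (v : Site k) :
    prescribed P K v = 0 ∨ prescribed P K v = 1 ∨ prescribed P K v = -1 :=
  hP.mem _ _ _

theorem IsPattern.mem_patternSites (hP : IsPattern P N) {v : Site k} :
    v ∈ patternSites P K N ↔ prescribed P K v ≠ 0 := by
  simp only [patternSites, Finset.mem_filter, Finset.mem_product, Finset.mem_Icc, Finset.mem_univ,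
    and_true, and_iff_right_iff_imp]
  exact hP.support _ _ _

theorem IsPattern.mk_mem_patternSites (hP : IsPattern P N) {a b : ℤ} {l : Fin k} :
    ((a, b), l) ∈ patternSites P K N ↔ P a b (min l K) ≠ 0 :=
  hP.mem_patternSites

theorem IsPattern.eq_prescribed (hP : IsPattern P N) {η : Config k}
    (hη : ∀ v ∈ patternSites P K N, η v = patternConfig P K v) {v : Site k}
    (hv : prescribed P K v ≠ 0) : (η v : ℤ) = prescribed P K v := by
  rw [hη v (hP.mem_patternSites.2 hv), patternConfig]
  rcases hP.mem_prescribed v with h | h | h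
  · exact absurd h hv
  · rw [h]; rfl
  · rw [h]; rfl

/-- Equal nonzero signs force the product of the spins to be 1. In all other cases, in particular if
`w` is unprescribed, the bound is the trivial -1: free neighbours count as hostile. -/
theorem IsPattern.agreement_le (hP : IsPattern P N) {η : Config k}
    (hη : ∀ v ∈ patternSites P K N, η v = patternConfig P K v) {v w : Site k}
    (hv : prescribed P K v ≠ 0) :
    agreement (prescribed P K v) (prescribed P K w) ≤ (η v : ℤ) * η w := by
  unfold agreement
  split_ifs with h
  · rw [hP.eq_prescribed hη hv, hP.eq_prescribed hη (h ▸ hv), ← h]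
    rcases hP.mem_prescribed v with h | h | h
    · exact absurd h hv
    · rw [h]; decide
    · rw [h]; decide
  · rcases Int.units_eq_one_or (η v) with h1 | h1 <;>
      rcases Int.units_eq_one_or (η w) with h2 | h2 <;> rw [h1, h2] <;> decide

theorem IsPattern.spin_eq (hP : IsPattern P N) {η : Config k}
    (hη : ∀ v ∈ patternSites P K N, η v = patternConfig P K v) {a b s : ℤ} {l : Fin k}
    (h : P a b (min l K) = s) (hs : s ≠ 0) : (η ((a, b), l) : ℤ) = s :=
  h ▸ hP.eq_prescribed hη (v := ((a, b), l)) (fun h0 => hs (h.symm.trans h0))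

/-- The numbers `u` and `d` are lower bounds for the vertical contributions, a missing edge
contributing 0. This slack allows levels of a thick slab to be compared with the finitely many
levels of a pattern. -/
theorem IsPattern.energy_neg (hP : IsPattern P N) (hk : 3 ≤ k) {η : Config k}
    (hη : ∀ v ∈ patternSites P K N, η v = patternConfig P K v) {a b : ℤ} {l : Fin k}
    (hv : P a b (min l K) ≠ 0) {u d : ℤ}
    (hu : HasUp bc l → u ≤ agreement (P a b (min l K)) (P a b (min (upLevel l : ℕ) K)))
    (hu0 : ¬ HasUp bc l → u ≤ 0)
    (hd : HasDown bc l → d ≤ agreement (P a b (min l K)) (P a b (min (downLevel l : ℕ) K)))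
    (hd0 : ¬ HasDown bc l → d ≤ 0) (hpos : 0 < horizontalAgreement P a b (min l K) + u + d) :
    energy bc η ((a, b), l) < 0 := by
  have hle := fun w => hP.agreement_le hη (v := ((a, b), l)) (w := w) hv
  rw [energy_eq hk, Left.neg_neg_iff]
  refine hpos.trans_le ?_
  rw [horizontalAgreement]
  gcongr
  · exact hle ((a + 1, b), l)
  · exact hle ((a - 1, b), l)
  · exact hle ((a, b + 1), l)
  · exact hle ((a, b - 1), l)
  · split_ifs with h
    · exact (hu h).trans (hle ((a, b), upLevel l))
    · exact hu0 h
  · split_ifs with h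
    · exact (hd h).trans (hle ((a, b), downLevel l))
    · exact hd0 h

end

/-! ### Stability of the two patterns -/

theorem isPattern_freePattern : IsPattern freePattern 4 where
  mem x y j := by
    unfold freePattern
    split_ifs
    · exact pictureSign_mem _ _ _ _ _
    · simp
  support x y j h := by
    simp only [freePattern, pictureSign, ne_eq, ite_eq_right_iff, Classical.not_imp] at h
    omega

theorem isPattern_periodicPattern : IsPattern periodicPattern 6 where
  mem x y j := by
    unfold periodicPattern
    split_ifs
    · exact pictureSign_mem _ _ _ _ _
    · simp
  support x y j h := by
    simp only [periodicPattern, pictureSign, ne_eq, ite_eq_right_iff, Classical.not_imp] at h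
    omega

/-- Level 0 has no neighbour below. Level 2 is tested without a neighbour above, as if it were the
top; in a thicker slab the level above it only helps. -/
theorem freePattern_stable : ∀ x ∈ Finset.Icc (-4 : ℤ) 4, ∀ y ∈ Finset.Icc (-4 : ℤ) 4,
    (freePattern x y 0 ≠ 0 → 0 < horizontalAgreement freePattern x y 0 +
      agreement (freePattern x y 0) (freePattern x y 1)) ∧
    (freePattern x y 1 ≠ 0 → 0 < horizontalAgreement freePattern x y 1 +
      agreement (freePattern x y 1) (freePattern x y 2) +
      agreement (freePattern x y 1) (freePattern x y 0)) ∧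
    (freePattern x y 2 ≠ 0 → 0 < horizontalAgreement freePattern x y 2 +
      agreement (freePattern x y 2) (freePattern x y 1)) := by
  decide +kernel

/-- This is the slab with exactly four levels, in cyclic order; thicker slabs reduce to it. -/
theorem periodicPattern_stable : ∀ x ∈ Finset.Icc (-6 : ℤ) 6, ∀ y ∈ Finset.Icc (-6 : ℤ) 6,
    ∀ j < 4, periodicPattern x y j ≠ 0 → 0 < horizontalAgreement periodicPattern x y j +
      agreement (periodicPattern x y j) (periodicPattern x y ((j + 1) % 4)) +
      agreement (periodicPattern x y j) (periodicPattern x y ((j + 3) % 4)) := by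
  decide +kernel

/-! ### Free boundary conditions -/

set_option maxRecDepth 4000 in
theorem isFrozen_freePattern (hk : 3 ≤ k) :
    IsFrozen .free (patternSites freePattern 2 4) (patternConfig freePattern 2 : Config k) := by
  rintro ⟨⟨a, b⟩, l⟩ hv η hη
  have hl := l.isLt
  have hv' : freePattern a b (min l 2) ≠ 0 := isPattern_freePattern.mk_mem_patternSites.1 hv
  obtain ⟨ha, hb⟩ := isPattern_freePattern.support _ _ _ hv'
  obtain ⟨h0, h1, h2⟩ := freePattern_stable a (Finset.mem_Icc.2 ha) b (Finset.mem_Icc.2 hb)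
  have hup := val_upLevel l
  have hdown := val_downLevel l
  rcases Nat.lt_trichotomy (l : ℕ) 1 with h | h | h
  · have e : min (l : ℕ) 2 = 0 := by omega
    have eu : min (upLevel l : ℕ) 2 = 1 := by rw [hup, if_pos (by omega)]; omega
    rw [e] at hv'
    refine isPattern_freePattern.energy_neg (d := 0) hk hη (by rwa [e]) (fun _ => le_rfl)
      (fun hn => absurd (fun _ => by omega) hn) (fun hd => ?_) (fun _ => le_rfl) ?_
    · have := hd rfl
      omega
    · rw [e, eu, add_zero]
      exact h0 hv'
  · have e : min (l : ℕ) 2 = 1 := by omega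
    have eu : min (upLevel l : ℕ) 2 = 2 := by rw [hup, if_pos (by omega)]; omega
    have ed : min (downLevel l : ℕ) 2 = 0 := by rw [hdown, if_neg (by omega)]; omega
    rw [e] at hv'
    refine isPattern_freePattern.energy_neg hk hη (by rwa [e]) (fun _ => le_rfl)
      (fun hn => absurd (fun _ => by omega) hn) (fun _ => le_rfl)
      (fun hn => absurd (fun _ => by omega) hn) ?_
    rw [e, eu, ed]
    exact h1 hv'
  · have e : min (l : ℕ) 2 = 2 := by omega
    rw [e] at hv'
    -- From level 2 on, the site above, if any, agrees. The site below agrees too when it is a copy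
    -- of the same level; otherwise it belongs to level 1, as in the finite check.
    refine isPattern_freePattern.energy_neg (u := 0)
      (d := agreement (freePattern a b 2) (freePattern a b 1)) hk hη (by rwa [e]) (fun hu => ?_)
      (fun _ => le_rfl) (fun _ => ?_) (fun hn => absurd (fun _ => by omega) hn) ?_
    · have eu : min (upLevel l : ℕ) 2 = 2 := by rw [hup, if_pos (hu rfl)]; omega
      rw [e, eu, agreement_self]
      exact zero_le_one
    · rw [hdown, if_neg (by omega), e]
      rcases Nat.lt_or_ge 2 (l : ℕ) with h' | h'
      · rw [show min ((l : ℕ) - 1) 2 = 2 by omega, agreement_self]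
        exact agreement_le_one _ _
      · rw [show min ((l : ℕ) - 1) 2 = 1 by omega]
    · rw [e, add_zero]
      exact h2 hv'

set_option maxRecDepth 4000 in
theorem not_slabFixates_free (hk : 3 ≤ k) : ¬ SlabFixates .free k := by
  set o : Fin k := ⟨1, by omega⟩ with ho
  have e : min (o : ℕ) 2 = 1 := rfl
  have eu : min (upLevel o : ℕ) 2 = 2 := by rw [val_upLevel, if_pos (by simp only [ho]; omega)]; rfl
  have ed : min (downLevel o : ℕ) 2 = 0 := by rw [val_downLevel, if_neg (by simp [ho])]; rfl
  -- The six neighbours of the unprescribed site (0,0,1): three plus, three minus.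
  have v1 : freePattern (0 + 1) 0 (min o 2) = 1 := by rw [e]; decide +kernel
  have v2 : freePattern (0 - 1) 0 (min o 2) = -1 := by rw [e]; decide +kernel
  have v3 : freePattern 0 (0 + 1) (min o 2) = -1 := by rw [e]; decide +kernel
  have v4 : freePattern 0 (0 - 1) (min o 2) = 1 := by rw [e]; decide +kernel
  have v5 : freePattern 0 0 (min (upLevel o) 2) = -1 := by rw [eu]; decide +kernel
  have v6 : freePattern 0 0 (min (downLevel o) 2) = 1 := by rw [ed]; decide +kernel
  have hne : ((-1 : ℤ)) ≠ 0 := by decide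
  intro h
  refine not_ae_siteFixates_of_isFrozen (isFrozen_freePattern hk)
    (U := {((0, 0), o)}) ?_ ?_ (h.mono fun ω hω u _ => hω u)
  · intro u hu y hy
    rw [Finset.mem_singleton] at hu
    subst hu
    left
    rcases mem_neighbors_of_edges_ne_zero hk hy with rfl | rfl | rfl | rfl | ⟨rfl, -⟩ | ⟨rfl, -⟩ <;>
      rw [isPattern_freePattern.mk_mem_patternSites]
    · exact ne_of_eq_of_ne v1 one_ne_zero
    · exact ne_of_eq_of_ne v2 hne
    · exact ne_of_eq_of_ne v3 hne
    · exact ne_of_eq_of_ne v4 one_ne_zero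
    · exact ne_of_eq_of_ne v5 hne
    · exact ne_of_eq_of_ne v6 one_ne_zero
  · intro η hη
    refine ⟨_, Finset.mem_singleton_self _, ?_⟩
    have hs := fun {a b s : ℤ} {l : Fin k} (h : freePattern a b (min l 2) = s) hs =>
      isPattern_freePattern.spin_eq hη h hs
    rw [energy_eq hk, hs v1 one_ne_zero, hs v2 hne, hs v3 hne, hs v4 one_ne_zero, hs v5 hne,
      hs v6 one_ne_zero, 
      if_pos (show HasUp .free o from fun _ => by simp only [ho]; omega),
      if_pos (show HasDown .free o from fun _ => by simp [ho])]
    apply le_of_eq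
    ring

/-! ### Periodic boundary conditions -/

set_option maxRecDepth 4000 in
theorem isFrozen_periodicPattern (hk : 4 ≤ k) : IsFrozen .periodic
    (patternSites periodicPattern 3 6) (patternConfig periodicPattern 3 : Config k) := by
  rintro ⟨⟨a, b⟩, l⟩ hv η hη
  have hl := l.isLt
  have hv' : periodicPattern a b (min l 3) ≠ 0 := isPattern_periodicPattern.mk_mem_patternSites.1 hv
  obtain ⟨ha, hb⟩ := isPattern_periodicPattern.support _ _ _ hv'
  have hst := periodicPattern_stable a (Finset.mem_Icc.2 ha) b (Finset.mem_Icc.2 hb) (min l 3)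
    (by omega) hv'
  refine isPattern_periodicPattern.energy_neg (by omega) hη hv' (fun _ => ?_)
    (fun hn => absurd nofun hn) (fun _ => ?_) (fun hn => absurd nofun hn) hst
  · rw [val_upLevel]
    -- Between two copies of level 3 the agreement is 1, at least the value in the four-level check;
    -- otherwise the step is the cyclic one modulo 4.
    by_cases h : 3 ≤ (l : ℕ) ∧ (l : ℕ) + 1 < k
    · rw [if_pos h.2, show min ((l : ℕ) + 1) 3 = min (l : ℕ) 3 by omega, agreement_self]
      exact agreement_le_one _ _
    · rw [show min (if (l : ℕ) + 1 < k then (l : ℕ) + 1 else 0) 3 = (min (l : ℕ) 3 + 1) % 4 by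
        split_ifs <;> omega]
  · rw [val_downLevel]
    by_cases h : 3 < (l : ℕ)
    · rw [if_neg (by omega), show min ((l : ℕ) - 1) 3 = min (l : ℕ) 3 by omega, agreement_self]
      exact agreement_le_one _ _
    · rw [show min (if (l : ℕ) = 0 then k - 1 else (l : ℕ) - 1) 3 = (min (l : ℕ) 3 + 3) % 4 by
        split_ifs <;> omega]

theorem periodicPattern_around_chain :
    periodicPattern (-1) 0 0 = 1 ∧ periodicPattern 4 0 0 = -1 ∧ ∀ i ∈ Finset.Icc (0 : ℤ) 3,
      periodicPattern i 1 0 = 1 ∧ periodicPattern i (-1) 0 = -1 ∧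
      periodicPattern i 0 1 = 1 ∧ periodicPattern i 0 3 = -1 := by
  decide +kernel

/-- The chain of the sites `(i, 0, 0)`, `0 ≤ i ≤ 3`. -/
def chain (o : Fin k) : Finset (Site k) := (Finset.Icc (0 : ℤ) 3).image fun i => ((i, 0), o)

theorem mem_chain {o : Fin k} {v : Site k} :
    v ∈ chain o ↔ ∃ i, (0 ≤ i ∧ i ≤ 3) ∧ ((i, 0), o) = v := by
  simp [chain]

theorem not_ae_chain_fixates (hk : 4 ≤ k) (o : Fin k) (ho : (o : ℕ) = 0) :
    ¬ ∀ᵐ ω ∂law k, ∀ u ∈ chain o, SiteFixates .periodic ω u := by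
  have e : min (o : ℕ) 3 = 0 := by omega
  have eu : min (upLevel o : ℕ) 3 = 1 := by rw [val_upLevel, if_pos (by omega)]; omega
  have ed : min (downLevel o : ℕ) 3 = 3 := by rw [val_downLevel, if_pos ho]; omega
  obtain ⟨hW, hE, hi⟩ := periodicPattern_around_chain
  have hne : ((-1 : ℤ)) ≠ 0 := by decide
  refine not_ae_siteFixates_of_isFrozen (isFrozen_periodicPattern hk) ?_ ?_
  · intro u hu y hy
    obtain ⟨i, h03, rfl⟩ := mem_chain.1 hu
    obtain ⟨hN, hS, hU, hD⟩ := hi i (Finset.mem_Icc.2 h03)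
    rcases mem_neighbors_of_edges_ne_zero (by omega) hy with
      rfl | rfl | rfl | rfl | ⟨rfl, -⟩ | ⟨rfl, -⟩ <;>
      rw [isPattern_periodicPattern.mk_mem_patternSites]
    · by_cases h : i = 3
      · rw [h, e]
        exact Or.inl (ne_of_eq_of_ne hE hne)
      · exact Or.inr (mem_chain.2 ⟨i + 1, by omega, rfl⟩)
    · by_cases h : i = 0
      · rw [h, e]
        exact Or.inl (ne_of_eq_of_ne hW one_ne_zero)
      · exact Or.inr (mem_chain.2 ⟨i - 1, by omega, rfl⟩)
    · rw [e]
      exact Or.inl (ne_of_eq_of_ne hN one_ne_zero)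
    · rw [e]
      exact Or.inl (ne_of_eq_of_ne hS hne)
    · rw [eu]
      exact Or.inl (ne_of_eq_of_ne hU one_ne_zero)
    · rw [ed]
      exact Or.inl (ne_of_eq_of_ne hD hne)
  · intro η hη
    have hs := fun {a b s : ℤ} {l : Fin k} (h : periodicPattern a b (min l 3) = s) hs =>
      isPattern_periodicPattern.spin_eq hη h hs
    -- The spins to the north and above are plus, those to the south and below minus, so only the
    -- two neighbours along the row remain.
    have hen : ∀ i : ℤ, 0 ≤ i ∧ i ≤ 3 → energy .periodic η ((i, 0), o) =
        - ((η ((i, 0), o) : ℤ) * (η ((i + 1, 0), o) + η ((i - 1, 0), o))) := by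
      intro i h03
      obtain ⟨hN, hS, hU, hD⟩ := hi i (Finset.mem_Icc.2 h03)
      rw [energy_eq (by omega), if_pos (show HasUp .periodic o from nofun),
        if_pos (show HasDown .periodic o from nofun),
        hs (s := 1) (b := 0 + 1) (by rw [e]; exact hN) one_ne_zero,
        hs (s := -1) (b := 0 - 1) (by rw [e]; exact hS) hne,
        hs (s := 1) (l := upLevel o) (by rw [eu]; exact hU) one_ne_zero,
        hs (s := -1) (l := downLevel o) (by rw [ed]; exact hD) hne]
      ring
    -- Negative energy along the whole row would make each of its spins equal to both neighbours in
    -- the row, carrying the plus at the west end to the minus at the east end.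
    by_contra! hc
    have hlt : ∀ i : ℤ, 0 ≤ i ∧ i ≤ 3 →
        0 < (η ((i, 0), o) : ℤ) * (η ((i + 1, 0), o) + η ((i - 1, 0), o)) := fun i h03 => by
      have := hc _ (mem_chain.2 ⟨i, h03, rfl⟩)
      rw [hen i h03] at this
      omega
    have h0 := hlt 0 (by decide)
    have h1 := hlt 1 (by decide)
    have h2 := hlt 2 (by decide)
    have h3 := hlt 3 (by decide)
    norm_num only at h0 h1 h2 h3
    rw [hs (a := -1) (by rw [e]; exact hW) one_ne_zero] at h0
    rw [hs (a := 4) (by rw [e]; exact hE) hne] at h3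
    rcases Int.units_eq_one_or (η ((0, 0), o)) with g0 | g0 <;>
    rcases Int.units_eq_one_or (η ((1, 0), o)) with g1 | g1 <;>
    rcases Int.units_eq_one_or (η ((2, 0), o)) with g2 | g2 <;>
    rcases Int.units_eq_one_or (η ((3, 0), o)) with g3 | g3 <;>
    simp [g0, g1, g2, g3] at h0 h1 h2 h3

/-- If one site fixated almost surely, so would all its translates, and hence the finitely many
sites of the chain simultaneously. -/
theorem not_ae_siteFixates_periodic (hk : 4 ≤ k) (o : Fin k) (ho : (o : ℕ) = 0) :
    ¬ ∀ᵐ ω ∂law k, SiteFixates .periodic ω ((0, 0), o) := by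
  intro h
  refine not_ae_chain_fixates hk o ho ((ae_ball_iff (chain o).countable_toSet).2 fun u hu => ?_)
  obtain ⟨i, -, rfl⟩ := mem_chain.1 hu
  have := ae_siteFixates_translate (i, 0) h
  simpa [translate] using this

end Coarsening

end

theorem theorem2 :
    (∀ (k : ℕ) (hk : 4 ≤ k),
      ¬ Coarsening.SlabFixates Coarsening.Boundary.periodic k ∧
      ¬ ∀ᵐ ω ∂(Coarsening.law k),
          Coarsening.SiteFixates Coarsening.Boundary.periodic ω ((0, 0), ⟨0, by omega⟩)) ∧
    (∀ k : ℕ, 3 ≤ k → ¬ Coarsening.SlabFixates Coarsening.Boundary.free k) := by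
  refine ⟨fun k hk => ?_, fun k hk => Coarsening.not_slabFixates_free hk⟩
  have h := Coarsening.not_ae_siteFixates_periodic hk ⟨0, by omega⟩ rfl
  exact ⟨fun hs => h (hs.mono fun ω hω => hω _), h⟩
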